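/- Let $\mathbb O=\mathbb H\oplus\mathbb H$ be the octonions, with product $(q_1,q_2)(p_1,p_2)=(q_1p_1-\bar p_2q_2,\;p_2q_1+q_2\bar p_1)$, conjugation $\overline{(q_1,q_2)}=(\bar q_1,-q_2)$ and norm $|a|^2=\mathrm{Re}(a\bar a)$. Put $U_1=\{1\}\times\mathbb O\times\mathbb O$, $U_2=\mathbb O\times\{1\}\times\mathbb O$, $U_3=\mathbb O\times\mathbb O\times\{1\}$ and $\mathcal U=U_1\cup U_2\cup U_3\subset\mathbb O^3$. Let $\sim$ be the equivalence relation on $\mathcal U$ given by $(a,b,c)\sim(d,e,f)$ iff $a=d\mu,\ b=e\mu,\ c=f\mu$ for some $\mu\in\mathbb O\setminus\{0\}$. Let $\mathbb OP^2=\mathcal U/{\sim}$, with $[a,b,c]$ denoting the class of $(a,b,c)$, and let $U_i/{\sim}$ denote the image of $U_i$ in $\mathbb OP^2$. Equip $\mathbb OP^2$ with the real-analytic manifold structure given by the three charts $U_i/{\sim}\to\mathbb O^2=\mathbb R^{16}$, $[1,u,v]\mapsto(u,v)$, $[u,1,v]\mapsto(u,v)$, $[u,v,1]\mapsto(u,v)$,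 and with the Riemannian metric given in each of these charts by $$ds^2=\frac{|du|^2(1+|v|^2)+|dv|^2(1+|u|^2)-2\,\mathrm{Re}[(u\bar v)(dv\,d\bar u)]}{(1+|u|^2+|v|^2)^2}.$$ Let $r\in\mathbb R$ and $\lambda\in\mathbb O$ satisfy $r^2+|\lambda|^2=1$. Then: 1. The map $\mathcal R_{r,\lambda}:U_1/{\sim}\to U_1/{\sim}$, $[1,u,v]\mapsto[1,\;ru+\lambda v,\;\bar\lambda u-rv]$, is an isometry of $U_1/{\sim}$: a real-analytic diffeomorphism of $U_1/{\sim}$ onto itself that preserves $ds^2$. 2. There is exactly one real-analytic map $\widetilde{\mathcal R}_{r,\lambda}:\mathbb OP^2\to\mathbb OP^2$ that extends $\mathcal R_{r,\lambda}$. It is an involution, $\widetilde{\mathcal R}_{r,\lambda}\circ\widetilde{\mathcal R}_{r,\lambda}=\mathrm{id}$, and an isometry of $\mathbb OP^2$: a real-analytic diffeomorphism that preserves $ds^2$. -/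

import Mathlib

open scoped Quaternion Manifold ContDiff

noncomputable section

/-- The octonions: the real inner product space `ℍ ⊕ ℍ` (Euclidean norm), with the
Cayley-Dickson multiplication defined below. -/
def Octonion : Type := WithLp 2 (ℍ[ℝ] × ℍ[ℝ])

namespace Octonion

instance : NormedAddCommGroup Octonion := inferInstanceAs (NormedAddCommGroup (WithLp 2 (ℍ[ℝ] × ℍ[ℝ])))
instance : InnerProductSpace ℝ Octonion := inferInstanceAs (InnerProductSpace ℝ (WithLp 2 (ℍ[ℝ] × ℍ[ℝ])))

/-- The octonion `(q₁, q₂)`. -/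
def mk (q₁ q₂ : ℍ[ℝ]) : Octonion := WithLp.toLp 2 (q₁, q₂)

/-- First quaternionic component. -/
def left (a : Octonion) : ℍ[ℝ] := (WithLp.ofLp a).1

/-- Second quaternionic component. -/
def right (a : Octonion) : ℍ[ℝ] := (WithLp.ofLp a).2

@[simp] theorem left_mk (p q : ℍ[ℝ]) : (mk p q).left = p := rfl
@[simp] theorem right_mk (p q : ℍ[ℝ]) : (mk p q).right = q := rfl

/-- `(q₁,q₂)(p₁,p₂) = (q₁p₁ - p̄₂q₂, p₂q₁ + q₂p̄₁)`. -/
instance : Mul Octonion :=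
  ⟨fun a b => mk (a.left * b.left - star b.right * a.right) (b.right * a.left + a.right * star b.left)⟩

instance : One Octonion := ⟨mk 1 0⟩

/-- Octonionic conjugation `(q₁,q₂) ↦ (q̄₁,-q₂)`. -/
instance : Star Octonion := ⟨fun a => mk (star a.left) (-a.right)⟩

/-- `a⁻¹ = |a|⁻² ā` (so `0⁻¹ = 0`). -/
instance : Inv Octonion := ⟨fun a => (‖a‖ ^ 2)⁻¹ • star a⟩

/-- The real part. -/
def re (a : Octonion) : ℝ := a.left.re

@[ext] theorem ext {a b : Octonion} (h₁ : a.left = b.left) (h₂ : a.right = b.right) : a = b :=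
  (WithLp.ofLp_injective 2) (Prod.ext h₁ h₂)

@[simp] theorem left_add (a b : Octonion) : (a + b).left = a.left + b.left := rfl
@[simp] theorem right_add (a b : Octonion) : (a + b).right = a.right + b.right := rfl
@[simp] theorem left_sub (a b : Octonion) : (a - b).left = a.left - b.left := rfl
@[simp] theorem right_sub (a b : Octonion) : (a - b).right = a.right - b.right := rfl
@[simp] theorem left_neg (a : Octonion) : (-a).left = -a.left := rfl
@[simp] theorem right_neg (a : Octonion) : (-a).right = -a.right := rfl
@[simp] theorem left_smul (r : ℝ) (a : Octonion) : (r • a).left = r • a.left := rfl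
@[simp] theorem right_smul (r : ℝ) (a : Octonion) : (r • a).right = r • a.right := rfl
@[simp] theorem left_zero : (0 : Octonion).left = 0 := rfl
@[simp] theorem right_zero : (0 : Octonion).right = 0 := rfl
@[simp] theorem left_one : (1 : Octonion).left = 1 := rfl
@[simp] theorem right_one : (1 : Octonion).right = 0 := rfl
@[simp] theorem left_star (a : Octonion) : (star a).left = star a.left := rfl
@[simp] theorem right_star (a : Octonion) : (star a).right = -a.right := rfl
@[simp] theorem left_mul (a b : Octonion) :
    (a * b).left = a.left * b.left - star b.right * a.right := rfl
@[simp] theorem right_mul (a b : Octonion) :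
    (a * b).right = b.right * a.left + a.right * star b.left := rfl

theorem inv_def (a : Octonion) : a⁻¹ = (‖a‖ ^ 2)⁻¹ • star a := rfl

theorem norm_sq_eq (a : Octonion) : ‖a‖ ^ 2 = ‖a.left‖ ^ 2 + ‖a.right‖ ^ 2 :=
  WithLp.prod_norm_sq_eq_of_L2 (α := ℍ[ℝ]) (β := ℍ[ℝ]) a

theorem norm_sq_eq_sum (a : Octonion) : ‖a‖ ^ 2 =
    (a.left.re ^ 2 + a.left.imI ^ 2 + a.left.imJ ^ 2 + a.left.imK ^ 2) +
      (a.right.re ^ 2 + a.right.imI ^ 2 + a.right.imJ ^ 2 + a.right.imK ^ 2) := by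
  rw [norm_sq_eq]
  simp only [pow_two ‖_‖, ← Quaternion.normSq_eq_norm_mul_self, Quaternion.normSq_def']

/-- The inner product of `ℍ ⊕ ℍ` is `⟨a, b⟩ = Re (a b̄)`. -/
theorem inner_eq_re (a b : Octonion) : inner ℝ a b = (a * star b).re := by
  have h : inner ℝ a b = inner ℝ a.left b.left + inner ℝ a.right b.right :=
    WithLp.prod_inner_apply (𝕜 := ℝ) (E := ℍ[ℝ]) (F := ℍ[ℝ]) a b
  rw [h, Quaternion.inner_def, Quaternion.inner_def]
  simp [re]
  ring

instance : NonAssocRing Octonion :=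
  { (inferInstance : AddCommGroup Octonion) with
    mul := (· * ·)
    one := 1
    left_distrib := fun a b c => by ext1 <;> simp [mul_add, add_mul] <;> abel
    right_distrib := fun a b c => by ext1 <;> simp [mul_add, add_mul] <;> abel
    zero_mul := fun a => by ext1 <;> simp
    mul_zero := fun a => by ext1 <;> simp
    one_mul := fun a => by ext1 <;> simp
    mul_one := fun a => by ext1 <;> simp }

theorem smul_mul (r : ℝ) (a b : Octonion) : (r • a) * b = r • (a * b) := by
  ext1 <;> simp [smul_sub, smul_add]

theorem mul_smul (r : ℝ) (a b : Octonion) : a * (r • b) = r • (a * b) := by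
  ext1 <;> simp [smul_sub, smul_add]

theorem mul_mul_star (a b : Octonion) : (a * b) * star b = (‖b‖ ^ 2) • a := by
  rw [norm_sq_eq_sum]
  ext <;> simp <;> ring

theorem star_mul_mul (a b : Octonion) : star a * (a * b) = (‖a‖ ^ 2) • b := by
  rw [norm_sq_eq_sum]
  ext <;> simp <;> ring

theorem star_star' (a : Octonion) : star (star a) = a := by
  ext1 <;> simp

theorem norm_star' (a : Octonion) : ‖star a‖ ^ 2 = ‖a‖ ^ 2 := by
  rw [norm_sq_eq, norm_sq_eq]; simp

theorem norm_sq_ne {a : Octonion} (h : a ≠ 0) : ‖a‖ ^ 2 ≠ 0 := by simpa using h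

theorem mul_mul_inv (a : Octonion) {b : Octonion} (h : b ≠ 0) : (a * b) * b⁻¹ = a := by
  rw [inv_def, mul_smul, mul_mul_star, smul_smul, inv_mul_cancel₀ (norm_sq_ne h), one_smul]

theorem inv_mul_mul {a : Octonion} (h : a ≠ 0) (b : Octonion) : a⁻¹ * (a * b) = b := by
  rw [inv_def, smul_mul, star_mul_mul, smul_smul, inv_mul_cancel₀ (norm_sq_ne h), one_smul]

theorem mul_inv_mul (a : Octonion) {b : Octonion} (h : b ≠ 0) : (a * b⁻¹) * b = a := by
  have := mul_mul_star a (star b)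
  rw [star_star', norm_star'] at this
  rw [inv_def, mul_smul, smul_mul, this, smul_smul, inv_mul_cancel₀ (norm_sq_ne h), one_smul]

theorem one_ne_zero' : (1 : Octonion) ≠ 0 := fun h => by
  have := congrArg (fun a : Octonion => a.left.re) h
  simp at this

theorem mul_inv_self {a : Octonion} (h : a ≠ 0) : a * a⁻¹ = 1 := by
  simpa using mul_mul_inv 1 h

theorem inv_mul_self {a : Octonion} (h : a ≠ 0) : a⁻¹ * a = 1 := by
  simpa using mul_inv_mul 1 h

theorem inv_ne_zero' {a : Octonion} (h : a ≠ 0) : a⁻¹ ≠ 0 := fun h0 => by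
  have := mul_inv_self h
  rw [h0, mul_zero] at this
  exact one_ne_zero' this.symm

theorem mul_ne_zero' {a b : Octonion} (ha : a ≠ 0) (hb : b ≠ 0) : a * b ≠ 0 := fun h => by
  have := mul_mul_inv a hb
  rw [h, zero_mul] at this
  exact ha this.symm

theorem ne_zero_left {a b : Octonion} (h : a * b = 1) : a ≠ 0 := fun h0 => by
  rw [h0, zero_mul] at h; exact one_ne_zero' h.symm

theorem ne_zero_right {a b : Octonion} (h : a * b = 1) : b ≠ 0 := fun h0 => by
  rw [h0, mul_zero] at h; exact one_ne_zero' h.symm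

theorem eq_inv_of_mul_eq_one {a b : Octonion} (h : a * b = 1) : b = a⁻¹ := by
  have := inv_mul_mul (ne_zero_left h) b
  rw [h, mul_one] at this; exact this.symm

/-- Associativity of three octonions when one of the relevant products is trivial. -/
theorem assoc_of {x m l : Octonion} (hm : m ≠ 0) (hl : l ≠ 0)
    (h : x = 1 ∨ m = 1 ∨ l = 1 ∨ x * m = 1 ∨ m * l = 1 ∨ (x * m) * l = 1) :
    (x * m) * l = x * (m * l) := by
  rcases h with rfl | rfl | rfl | h | h | h
  · simp
  · simp
  · simp
  · have hx := ne_zero_left h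
    have : m = x⁻¹ := eq_inv_of_mul_eq_one h
    have h2 : x * (m * l) = l := by
      have h3 := star_mul_mul (star x) l
      rw [star_star', norm_star'] at h3
      rw [this, inv_def, smul_mul, mul_smul, h3, smul_smul, inv_mul_cancel₀ (norm_sq_ne hx), one_smul]
    rw [h, h2, one_mul]
  · rw [h, mul_one, eq_inv_of_mul_eq_one h, mul_mul_inv x hm]
  · have h1 : x * m = l⁻¹ := by
      have := mul_mul_inv (x * m) hl
      rw [h, one_mul] at this; exact this.symm
    have h2 : x = l⁻¹ * m⁻¹ := by rw [← h1, mul_mul_inv x hm]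
    have h3 : m * l ≠ 0 := mul_ne_zero' hm hl
    have h4 : star (m * l) = star l * star m := by
      ext <;> simp
    have h5 : ‖m * l‖ ^ 2 = ‖m‖ ^ 2 * ‖l‖ ^ 2 := by
      rw [norm_sq_eq_sum, norm_sq_eq_sum, norm_sq_eq_sum]; simp; ring
    have h6 : (m * l)⁻¹ = l⁻¹ * m⁻¹ := by
      rw [inv_def, inv_def, inv_def, smul_mul, mul_smul, smul_smul, h4, h5, mul_inv, mul_comm (‖m‖ ^ 2)⁻¹]
    rw [h, h2, ← h6, inv_mul_self h3]

end Octonion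

/-- The set `𝒰 = U₁ ∪ U₂ ∪ U₃ ⊆ 𝕆³` of reduced homogeneous coordinates: triples with some entry
equal to `1` (indices `0, 1, 2` stand for `1, 2, 3`). -/
abbrev ReducedTriple : Type := {x : Fin 3 → Octonion // ∃ i, x i = 1}

/-- `x ∼ y` if `x = y l` entrywise for some nonzero octonion `l`. -/
def ReducedTriple.Rel (x y : ReducedTriple) : Prop :=
  ∃ l : Octonion, l ≠ 0 ∧ ∀ k, x.1 k = y.1 k * l

theorem ReducedTriple.Rel.equivalence : Equivalence ReducedTriple.Rel where
  refl x := ⟨1, Octonion.one_ne_zero', fun k => (mul_one _).symm⟩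
  symm := by
    rintro x y ⟨l, hl, h⟩
    exact ⟨l⁻¹, Octonion.inv_ne_zero' hl, fun k => by rw [h k, Octonion.mul_mul_inv _ hl]⟩
  trans := by
    rintro ⟨x, k₀, hx⟩ ⟨y, j, hy⟩ ⟨z, i, hz⟩ ⟨l, hl, h⟩ ⟨m, hm, h'⟩
    simp only at h h'
    refine ⟨m * l, Octonion.mul_ne_zero' hm hl, fun k => ?_⟩
    show x k = z k * (m * l)
    have hxk : ∀ k, x k = (z k * m) * l := fun k => by rw [h k, h' k]
    rw [hxk k]
    apply Octonion.assoc_of hm hl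
    have key : k = i ∨ k = j ∨ k = k₀ ∨ i = j ∨ i = k₀ ∨ j = k₀ := by omega
    rcases key with rfl | rfl | rfl | rfl | rfl | rfl
    · exact Or.inl hz
    · right; right; right; left; rw [← h' k, hy]
    · right; right; right; right; right; rw [← hxk k, hx]
    · right; left
      have := h' i
      rw [hy, hz, one_mul] at this
      exact this.symm
    · right; right; right; right; left
      rw [← hx, hxk i, hz, one_mul]
    · right; right; left
      have := h j
      rw [hx, hy, one_mul] at this
      exact this.symm

instance ReducedTriple.setoid : Setoid ReducedTriple := ⟨ReducedTriple.Rel, ReducedTriple.Rel.equivalence⟩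

/-- The octonionic projective plane `𝕆P² = 𝒰/∼`. -/
def OP2 : Type := Quotient ReducedTriple.setoid

namespace OP2

open Octonion

/-- The model space `𝕆 × 𝕆 = ℝ¹⁶`. -/
abbrev Model : Type := Octonion × Octonion

/-- The triples `(1,u,v)`, `(u,1,v)`, `(u,v,1)` for `i = 0, 1, 2`. -/
def triple (i : Fin 3) (w : Model) : Fin 3 → Octonion :=
  match i with
  | 0 => ![1, w.1, w.2]
  | 1 => ![w.1, 1, w.2]
  | 2 => ![w.1, w.2, 1]

/-- The entries of a triple other than the `i`-th. -/
def entries (i : Fin 3) (x : Fin 3 → Octonion) : Model :=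
  match i with
  | 0 => (x 1, x 2)
  | 1 => (x 0, x 2)
  | 2 => (x 0, x 1)

theorem triple_self (i : Fin 3) (w : Model) : triple i w i = 1 := by
  fin_cases i <;> rfl

theorem entries_triple (i : Fin 3) (w : Model) : entries i (triple i w) = w := by
  fin_cases i <;> rfl

theorem triple_entries (i : Fin 3) (x : Fin 3 → Octonion) (h : x i = 1) :
    triple i (entries i x) = x := by
  funext k
  fin_cases i <;> fin_cases k <;> first | rfl | exact h.symm

/-- The points `[1,u,v]`, `[u,1,v]`, `[u,v,1]` of `𝕆P²` for `i = 0, 1, 2`. -/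
def point (i : Fin 3) (w : Model) : OP2 :=
  Quotient.mk ReducedTriple.setoid ⟨triple i w, i, triple_self i w⟩

theorem point_eq_iff (i j : Fin 3) (w z : Model) :
    point i w = point j z ↔ ∃ l : Octonion, l ≠ 0 ∧ ∀ k, triple i w k = triple j z k * l :=
  Quotient.eq (r := ReducedTriple.setoid)

theorem exists_point (p : OP2) : ∃ i w, point i w = p := by
  induction p using Quotient.inductionOn with
  | h x =>
    obtain ⟨x, i, hi⟩ := x
    refine ⟨i, entries i x, ?_⟩
    unfold point
    congr 2
    exact triple_entries i x hi

theorem point_injective (i : Fin 3) : Function.Injective (point i) := fun w z h => by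
  obtain ⟨l, -, hl⟩ := (point_eq_iff i i w z).1 h
  have h1 : l = 1 := by simpa [triple_self] using (hl i).symm
  rw [← entries_triple i w, ← entries_triple i z]
  congr 1
  funext k
  rw [hl k, h1, mul_one]

/-- The subset `Uᵢ/∼` of `𝕆P²`. -/
def affine (i : Fin 3) : Set OP2 := Set.range (point i)

/-- The change of coordinates from the `i`-th to the `j`-th chart. -/
def transition (i j : Fin 3) (w : Model) : Model :=
  entries j (fun k => triple i w k * (triple i w j)⁻¹)

theorem point_transition (i j : Fin 3) (w : Model) (h : triple i w j ≠ 0) :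
    point j (transition i j w) = point i w := by
  refine (point_eq_iff j i _ _).2 ⟨(triple i w j)⁻¹, inv_ne_zero' h, fun k => ?_⟩
  rw [transition, triple_entries j _ (mul_inv_self h)]

theorem point_mem_affine_iff (i j : Fin 3) (w : Model) :
    point i w ∈ affine j ↔ triple i w j ≠ 0 := by
  constructor
  · rintro ⟨z, hz⟩ h0
    obtain ⟨l, -, hl⟩ := (point_eq_iff j i z w).1 hz
    have := hl j
    rw [h0, zero_mul, triple_self] at this
    exact one_ne_zero' this
  · exact fun h => ⟨_, point_transition i j w h⟩

/-- The chart `φᵢ : Uᵢ/∼ → 𝕆 × 𝕆` as a partial bijection; it is the inverse of `point i`, so that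
for instance `φ₁ [1,u,v] = (u,v)`. -/
def affineEquiv (i : Fin 3) : PartialEquiv OP2 Model where
  toFun := Function.invFun (point i)
  invFun := point i
  source := affine i
  target := Set.univ
  map_source' _ _ := Set.mem_univ _
  map_target' w _ := Set.mem_range_self w
  left_inv' _ hp := Function.invFun_eq hp
  right_inv' w _ := Function.leftInverse_invFun (point_injective i) w

theorem affineEquiv_point (i : Fin 3) (w : Model) : affineEquiv i (point i w) = w :=
  Function.leftInverse_invFun (point_injective i) w

theorem affineEquiv_point_eq (i j : Fin 3) (w : Model) (h : triple i w j ≠ 0) :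
    affineEquiv j (point i w) = transition i j w := by
  rw [← point_transition i j w h, affineEquiv_point]

theorem contDiff_triple (i k : Fin 3) : ContDiff ℝ ω (fun w : Model => triple i w k) := by
  fin_cases i <;> fin_cases k <;>
    first | exact contDiff_const | exact contDiff_fst | exact contDiff_snd

instance : FiniteDimensional ℝ Octonion :=
  inferInstanceAs (FiniteDimensional ℝ (WithLp 2 (ℍ[ℝ] × ℍ[ℝ])))

theorem contDiff_mul : ContDiff ℝ ω (fun p : Octonion × Octonion => p.1 * p.2) := by
  let B : Octonion →ₗ[ℝ] Octonion →ₗ[ℝ] Octonion :=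
    LinearMap.mk₂ ℝ (· * ·) (fun a b c => add_mul a b c) (fun r a b => Octonion.smul_mul r a b)
      (fun a b c => mul_add a b c) (fun r a b => Octonion.mul_smul r a b)
  let C : Octonion →ₗ[ℝ] Octonion →L[ℝ] Octonion :=
    (LinearMap.toContinuousLinearMap : (Octonion →ₗ[ℝ] Octonion) ≃ₗ[ℝ] _).toLinearMap ∘ₗ B
  exact (LinearMap.toContinuousLinearMap C).isBoundedBilinearMap.contDiff

theorem contDiffOn_inv : ContDiffOn ℝ ω (fun a : Octonion => a⁻¹) {0}ᶜ := by
  let S : Octonion →ₗ[ℝ] Octonion :=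
    { toFun := star
      map_add' := fun a b => by ext1 <;> simp [add_comm]
      map_smul' := fun r a => by ext1 <;> simp }
  have hS : ContDiff ℝ ω (fun a : Octonion => star a) :=
    (LinearMap.toContinuousLinearMap S).contDiff
  have hN : ContDiff ℝ ω (fun a : Octonion => ‖a‖ ^ 2) := contDiff_norm_sq ℝ
  have hI : ContDiffOn ℝ ω (fun a : Octonion => (‖a‖ ^ 2)⁻¹) {0}ᶜ :=
    hN.contDiffOn.inv fun a ha => norm_sq_ne ha
  exact (hI.smul hS.contDiffOn).congr fun a _ => inv_def a

theorem contDiffOn_triple_inv (i j : Fin 3) :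
    ContDiffOn ℝ ω (fun w => (triple i w j)⁻¹) {w | triple i w j ≠ 0} := by
  have := ContDiffOn.comp (g := fun a : Octonion => a⁻¹) contDiffOn_inv
    (contDiff_triple i j).contDiffOn (s := {w | triple i w j ≠ 0})
    (fun w hw => Set.mem_compl_singleton_iff.2 hw)
  exact this

theorem contDiffOn_triple_div (i j k : Fin 3) :
    ContDiffOn ℝ ω (fun w => triple i w k * (triple i w j)⁻¹) {w | triple i w j ≠ 0} := by
  have h2 : ContDiffOn ℝ ω (fun w => triple i w k) {w | triple i w j ≠ 0} :=
    (contDiff_triple i k).contDiffOn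
  have h3 := h2.prodMk (contDiffOn_triple_inv i j)
  have := ContDiff.comp_contDiffOn (g := fun p : Octonion × Octonion => p.1 * p.2) contDiff_mul h3
  exact this

theorem contDiffOn_transition (i j : Fin 3) :
    ContDiffOn ℝ ω (transition i j) {w | triple i w j ≠ 0} := by
  have h := contDiffOn_triple_div i j
  unfold transition entries
  fin_cases j
  · exact (h 1).prodMk (h 2)
  · exact (h 0).prodMk (h 2)
  · exact (h 0).prodMk (h 1)

theorem trans_source (i j : Fin 3) :
    ((affineEquiv i).symm.trans (affineEquiv j)).source = {w | triple i w j ≠ 0} := by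
  ext w
  rw [PartialEquiv.trans_source, Set.mem_ofPred_eq, ← point_mem_affine_iff]
  exact ⟨fun h => h.2, fun h => ⟨Set.mem_univ _, h⟩⟩

theorem trans_eqOn (i j : Fin 3) : Set.EqOn ((affineEquiv i).symm.trans (affineEquiv j))
    (transition i j) {w | triple i w j ≠ 0} :=
  fun w hw => affineEquiv_point_eq i j w hw

theorem exists_mem_affine (p : OP2) : ∃ i, p ∈ affine i := by
  obtain ⟨i, w, h⟩ := exists_point p
  exact ⟨i, w, h⟩

/-- The atlas `(Uᵢ/∼, φᵢ)`, `i = 1, 2, 3`. -/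
def atlasCore : ChartedSpaceCore Model OP2 where
  atlas := Set.range affineEquiv
  chartAt p := affineEquiv (exists_mem_affine p).choose
  mem_chart_source p := (exists_mem_affine p).choose_spec
  chart_mem_atlas p := Set.mem_range_self _
  open_source := by
    rintro _ _ ⟨i, rfl⟩ ⟨j, rfl⟩
    rw [trans_source]
    exact isOpen_ne_fun (contDiff_triple i j).continuous continuous_const
  continuousOn_toFun := by
    rintro _ _ ⟨i, rfl⟩ ⟨j, rfl⟩
    rw [trans_source]
    exact (contDiffOn_transition i j).continuousOn.congr (trans_eqOn i j)

/-- The topology of `𝕆P²`, determined by the atlas. -/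
instance : TopologicalSpace OP2 := atlasCore.toTopologicalSpace

instance : ChartedSpace Model OP2 := atlasCore.toChartedSpace

theorem mem_atlas_iff {e : OpenPartialHomeomorph OP2 Model} : e ∈ atlas Model OP2 ↔
    ∃ (e' : PartialEquiv OP2 Model) (h : e' ∈ Set.range affineEquiv),
      e = atlasCore.openPartialHomeomorph e' h := by
  show e ∈ (⋃ (e' : PartialEquiv OP2 Model) (he : e' ∈ atlasCore.atlas),
    {atlasCore.openPartialHomeomorph e' he}) ↔ _
  simp only [Set.mem_iUnion, Set.mem_singleton_iff]
  rfl

/-- `𝕆P²` is a real analytic manifold. -/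
instance : IsManifold 𝓘(ℝ, Model) ω OP2 := by
  apply isManifold_of_contDiffOn
  intro e e' he he'
  obtain ⟨_, ⟨i, rfl⟩, rfl⟩ := mem_atlas_iff.1 he
  obtain ⟨_, ⟨j, rfl⟩, rfl⟩ := mem_atlas_iff.1 he'
  have h := (contDiffOn_transition i j).congr (trans_eqOn i j)
  rw [← trans_source] at h
  simp only [modelWithCornersSelf_coe, modelWithCornersSelf_coe_symm, Set.range_id, Set.inter_univ,
    Set.preimage_id, Function.comp_id, Function.id_comp]
  exact h

/-- The line element
`ds² = (|du|²(1+|v|²) + |dv|²(1+|u|²) - 2 Re[(u v̄)(dv dū)]) / (1+|u|²+|v|²)²`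
at the point with coordinates `w = (u,v)`, on the vector `d = (du,dv)`. -/
def lineElement (w d : Model) : ℝ :=
  (‖d.1‖ ^ 2 * (1 + ‖w.2‖ ^ 2) + ‖d.2‖ ^ 2 * (1 + ‖w.1‖ ^ 2)
      - 2 * ((w.1 * star w.2) * (d.2 * star d.1)).re) /
    (1 + ‖w.1‖ ^ 2 + ‖w.2‖ ^ 2) ^ 2

/-- `ds²(ξ)` for a tangent vector `ξ` at `p`, computed in the coordinates of the chart `φᵢ`
(meaningful for `p ∈ Uᵢ/∼`). -/
def dsSq (i : Fin 3) (p : OP2) (ξ : TangentSpace 𝓘(ℝ, Model) p) : ℝ :=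
  lineElement (affineEquiv i p) (mfderiv 𝓘(ℝ, Model) 𝓘(ℝ, Model) (affineEquiv i) p ξ)

/-- `f` restricts to an (analytic) isometry from the open set `U` onto the open set `V`: it is an
analytic bijection `U → V` with analytic inverse, and it preserves `ds²`, whichever of the charts
are used to compute it at the source and at the target. -/
structure IsIsometryOn (f : OP2 → OP2) (U V : Set OP2) : Prop where
  isOpen_source : IsOpen U
  isOpen_target : IsOpen V
  bijOn : Set.BijOn f U V
  contMDiffOn : ContMDiffOn 𝓘(ℝ, Model) 𝓘(ℝ, Model) ω f U
  contMDiffOn_inverse : ∃ g : OP2 → OP2, Set.InvOn g f U V ∧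
    ContMDiffOn 𝓘(ℝ, Model) 𝓘(ℝ, Model) ω g V
  dsSq_map : ∀ p ∈ U, ∀ i j : Fin 3, p ∈ affine i → f p ∈ affine j →
    ∀ ξ : TangentSpace 𝓘(ℝ, Model) p,
      dsSq j (f p) (mfderiv 𝓘(ℝ, Model) 𝓘(ℝ, Model) f p ξ) = dsSq i p ξ

/-- The map `[1,u,v] ↦ [1, ru + λv, λ̄u - rv]`. Only its restriction to `U₁/∼ = affine 0` is
meaningful. -/
def reflection (r : ℝ) (l : Octonion) (p : OP2) : OP2 :=
  point 0 (r • (affineEquiv 0 p).1 + l * (affineEquiv 0 p).2,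
    star l * (affineEquiv 0 p).1 - r • (affineEquiv 0 p).2)

theorem reflection_point (r : ℝ) (l u v : Octonion) :
    reflection r l (point 0 (u, v)) = point 0 (r • u + l * v, star l * u - r • v) := by
  rw [reflection, affineEquiv_point]

end OP2

end

/-! The formula for the reflection makes sense only on one chart, but it becomes linear after an
embedding. Send `[x]` to the Hermitian matrix `x x* / |x|²` (`veronese`). Although octonions do not
associate, this is well defined on reduced triples, and it is injective because a column divided by
its diagonal entry returns affine coordinates.

Three facts carry the proof. The line element is half the Hilbert-Schmidt metric pulled back by
`veronese` (`dsSq_eq_hsNormSq`). On the chart `affine 0` the reflection is induced by a linear map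
`hermReflection` of Hermitian matrices (`veronese_reflection_point`), where the middle Moufang
identity enters. That linear map preserves the Hilbert-Schmidt norm (`hsNormSq_hermReflection`) and
maps the image of `veronese` into itself (`exists_veronese_eq_hermReflection`).

Hence the linear map induces a map of the whole plane. It is analytic because `veronese` has local
analytic left inverses, and it preserves the metric because a linear map is its own derivative. The
chart is dense and the plane is Hausdorff, which gives involutivity and uniqueness. -/

noncomputable section

/-! ### Octonion identities: adjoints, polarization, Moufang. -/

namespace Octonion

theorem inner_eq_sum (a b : Octonion) : inner ℝ a b =
    a.left.re * b.left.re + a.left.imI * b.left.imI + a.left.imJ * b.left.imJ +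
      a.left.imK * b.left.imK + a.right.re * b.right.re + a.right.imI * b.right.imI +
      a.right.imJ * b.right.imJ + a.right.imK * b.right.imK := by
  rw [inner_eq_re]
  simp [re]
  ring

theorem norm_mul_sq (a b : Octonion) : ‖a * b‖ ^ 2 = ‖a‖ ^ 2 * ‖b‖ ^ 2 := by
  rw [norm_sq_eq_sum, norm_sq_eq_sum, norm_sq_eq_sum]
  simp
  ring

theorem star_mul' (a b : Octonion) : star (a * b) = star b * star a := by
  ext <;> simp

theorem star_add' (a b : Octonion) : star (a + b) = star a + star b := by
  ext1 <;> simp [add_comm]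

theorem star_smul' (r : ℝ) (a : Octonion) : star (r • a) = r • star a := by
  ext1 <;> simp

theorem star_zero' : star (0 : Octonion) = 0 := by
  ext1 <;> simp

theorem star_one' : star (1 : Octonion) = 1 := by
  ext1 <;> simp

theorem norm_one_sq : ‖(1 : Octonion)‖ ^ 2 = 1 := by
  rw [norm_sq_eq_sum]
  simp

theorem inner_star (a b : Octonion) : inner ℝ (star a) (star b) = inner ℝ a b := by
  simp only [inner_eq_sum]
  simp

theorem mul_star_mul (a b : Octonion) : a * (star a * b) = (‖a‖ ^ 2) • b := by
  simpa [star_star', norm_star'] using star_mul_mul (star a) b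

theorem inner_mul_left (a b c : Octonion) : inner ℝ (a * b) c = inner ℝ b (star a * c) := by
  simp only [inner_eq_sum]
  simp
  ring

theorem inner_mul_right (a b c : Octonion) : inner ℝ (a * b) c = inner ℝ a (c * star b) := by
  simp only [inner_eq_sum]
  simp
  ring

theorem inner_mul_mul_right (a b c : Octonion) :
    inner ℝ (a * c) (b * c) = ‖c‖ ^ 2 * inner ℝ a b := by
  rw [inner_mul_right, mul_mul_star, inner_smul_right]

theorem inner_mul_mul_left (a b c : Octonion) :
    inner ℝ (c * a) (c * b) = ‖c‖ ^ 2 * inner ℝ a b := by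
  rw [inner_mul_left, star_mul_mul, inner_smul_right]

/-- Polarization of the multiplicativity of the norm. -/
theorem inner_mul_mul_add (a b c d : Octonion) :
    inner ℝ (a * c) (b * d) + inner ℝ (a * d) (b * c) = 2 * inner ℝ a b * inner ℝ c d := by
  have h := inner_mul_mul_right a b (c + d)
  rw [mul_add, mul_add, inner_add_left, inner_add_right, inner_add_right, inner_mul_mul_right,
    inner_mul_mul_right, norm_add_sq_real] at h
  linear_combination h

/-- Polarization puts the mixed term of the line element into the shape in which it arises from the
norm of a matrix entry. -/
theorem re_mul_mul_star (u v a b : Octonion) :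
    ((u * star v) * (b * star a)).re =
      2 * inner ℝ u a * inner ℝ v b - inner ℝ (u * star b) (a * star v) := by
  have h := inner_mul_mul_add u a (star v) (star b)
  have h2 : ((u * star v) * (b * star a)).re = inner ℝ (u * star v) (a * star b) := by
    rw [inner_eq_re, star_mul', star_star']
  rw [inner_star] at h
  linear_combination h2 + h

/-- The middle Moufang identity, in a form that avoids triple products. -/
theorem mul_mul_star_mul_self (l v u : Octonion) :
    (l * v) * (star u * l) = (2 * inner ℝ l (u * star v)) • l - (‖l‖ ^ 2) • (u * star v) := by
  -- Pairing with an arbitrary `z` lets adjointness move factors across the inner product, so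
  -- polarization applies and no reassociation is needed.
  refine ext_inner_right ℝ fun z => ?_
  have h := inner_mul_mul_add l z v (star l * u)
  rw [mul_star_mul, inner_smul_left, real_inner_comm (z * v), inner_mul_right z v u,
    real_inner_comm (u * star v), ← inner_mul_left l v u, inner_mul_right l v u] at h
  rw [inner_mul_right, star_mul', star_star', inner_sub_left, inner_smul_left, inner_smul_left]
  simp only [conj_trivial] at h ⊢
  linear_combination h

/-- Conjugation as a linear map. -/
def starLinear : Octonion →ₗ[ℝ] Octonion where
  toFun := star
  map_add' := star_add'
  map_smul' := star_smul'

theorem contDiff_star : ContDiff ℝ ω (fun a : Octonion => star a) :=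
  (LinearMap.toContinuousLinearMap starLinear).contDiff

end Octonion

/-! ### The Veronese embedding. -/

namespace OP2

open Octonion

/-- The space of Hermitian octonionic `3 × 3` matrices: a diagonal `d₀, d₁, d₂` and the entries
in the positions `(0,1), (1,2), (2,0)`. -/
abbrev Herm : Type := (Fin 3 → ℝ) × (Fin 3 → Octonion)

/-- The squared Hilbert-Schmidt norm of a Hermitian matrix. -/
def hsNormSq (X : Herm) : ℝ :=
  ∑ k, (X.1 k ^ 2 + 2 * ‖X.2 k‖ ^ 2)

/-- The matrix `x x*`. -/
def outer (x : Fin 3 → Octonion) : Herm :=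
  (fun k => ‖x k‖ ^ 2, fun k => x k * star (x (k + 1)))

/-- The squared norm of a triple. -/
def normSq (x : Fin 3 → Octonion) : ℝ := ∑ k, ‖x k‖ ^ 2

theorem normSq_pos {x : Fin 3 → Octonion} {i : Fin 3} (h : x i = 1) : 0 < normSq x := by
  refine Finset.sum_pos' (fun k _ => sq_nonneg _) ⟨i, Finset.mem_univ i, ?_⟩
  rw [h, norm_one_sq]
  exact one_pos

/-- The matrix of the orthogonal projection onto the line spanned by a triple. -/
def projMatrix (x : Fin 3 → Octonion) : Herm := (normSq x)⁻¹ • outer x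

/-- Without associativity this fails for general `a`, `b`; in each listed case one factor collapses
and alternativity suffices. -/
theorem mul_mul_star_mul {a b l : Octonion} (h : a = 1 ∨ b = 1 ∨ a * l = 1 ∨ b * l = 1) :
    (a * l) * star (b * l) = (‖l‖ ^ 2) • (a * star b) := by
  rcases h with rfl | rfl | h | h
  · rw [one_mul, one_mul, star_mul', mul_star_mul]
  · rw [one_mul, mul_mul_star, star_one', mul_one]
  · have ha : (‖l‖ ^ 2) • a = star l := by rw [← mul_mul_star, h, one_mul]
    rw [h, one_mul, ← Octonion.smul_mul, ha, star_mul']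
  · have hb : (‖l‖ ^ 2) • star b = l := by
      rw [← star_smul', ← mul_mul_star, h, one_mul, star_star']
    rw [h, star_one', mul_one, ← Octonion.mul_smul, hb]

theorem projMatrix_eq_of_rel {x y : ReducedTriple} (h : x ≈ y) :
    projMatrix x.1 = projMatrix y.1 := by
  obtain ⟨x, i, hx⟩ := x
  obtain ⟨y, j, hy⟩ := y
  obtain ⟨l, hl, h⟩ := h
  simp only at h ⊢
  have hd : ∀ k, ‖x k‖ ^ 2 = ‖l‖ ^ 2 * ‖y k‖ ^ 2 := fun k => by
    rw [h k, norm_mul_sq, mul_comm]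
  have ho : ∀ k, x k * star (x (k + 1)) = (‖l‖ ^ 2) • (y k * star (y (k + 1))) := by
    intro k
    by_cases hij : i = j
    · subst hij
      have h1 : l = 1 := by rw [← hx, h, hy, one_mul]
      rw [h, h, h1, norm_one_sq, one_smul, mul_one, mul_one]
    · rw [h k, h (k + 1)]
      apply mul_mul_star_mul
      rw [← h, ← h]
      -- Two two-element subsets of a three-element set meet, so `{k, k + 1}` contains an index
      -- where `x` or `y` has entry `1`.
      have key : k = j ∨ k + 1 = j ∨ k = i ∨ k + 1 = i := by omega
      rcases key with rfl | rfl | rfl | rfl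
      · exact Or.inl hy
      · exact Or.inr (Or.inl hy)
      · exact Or.inr (Or.inr (Or.inl hx))
      · exact Or.inr (Or.inr (Or.inr hx))
  have hN : normSq x = ‖l‖ ^ 2 * normSq y := by
    rw [normSq, normSq, Finset.mul_sum]
    exact Finset.sum_congr rfl fun k _ => hd k
  have hO : outer x = (‖l‖ ^ 2) • outer y := Prod.ext (funext hd) (funext ho)
  rw [projMatrix, projMatrix, hN, hO, smul_smul, mul_inv, mul_right_comm,
    inv_mul_cancel₀ (norm_sq_ne hl), one_mul]

/-- The Veronese embedding of `𝕆P²` into the Hermitian matrices. -/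
def veronese : OP2 → Herm :=
  Quotient.lift (fun x : ReducedTriple => projMatrix x.1) fun _ _ => projMatrix_eq_of_rel

theorem veronese_point (i : Fin 3) (w : Model) :
    veronese (point i w) = projMatrix (triple i w) := rfl

/-- The affine coordinates of the line with a given projection matrix. -/
def affineCoord (j : Fin 3) (X : Herm) : Model :=
  -- This is column `j` divided by its diagonal entry: position `(j+1, j)` is the conjugate of the
  -- stored `(j, j+1)`, and `(j+2, j)` is stored directly since indices are mod 3. The value at `k =
  -- j` is junk that `entries j` discards.
  entries j fun k => (X.1 j)⁻¹ • if k = j + 1 then star (X.2 j) else X.2 (j + 2)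

theorem veronese_point_diag (i : Fin 3) (w : Model) (j : Fin 3) :
    (veronese (point i w)).1 j = (normSq (triple i w))⁻¹ * ‖triple i w j‖ ^ 2 := rfl

/-- The diagonal entry is `|x_j|² / |x|²`; membership in a chart thus becomes an open condition on
the matrix. -/
theorem veronese_diag_ne_zero_iff (p : OP2) (j : Fin 3) :
    (veronese p).1 j ≠ 0 ↔ p ∈ affine j := by
  obtain ⟨i, w, rfl⟩ := exists_point p
  rw [point_mem_affine_iff, veronese_point_diag]
  have := (normSq_pos (triple_self i w)).ne'
  simp [this]

theorem affineCoord_veronese_point (j : Fin 3) (w : Model) :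
    affineCoord j (veronese (point j w)) = w := by
  have hN := (normSq_pos (triple_self j w)).ne'
  have hd : (veronese (point j w)).1 j = (normSq (triple j w))⁻¹ := by
    rw [veronese_point_diag, triple_self, norm_one_sq, mul_one]
  have ho : ∀ k, (normSq (triple j w)) • (veronese (point j w)).2 k =
      triple j w k * star (triple j w (k + 1)) := fun k => smul_inv_smul₀ hN _
  rw [affineCoord, hd, inv_inv]
  simp only [smul_ite, ← star_smul', ho]
  fin_cases j <;> simp [entries, triple, star_star', star_one']

theorem affineCoord_veronese {p : OP2} {j : Fin 3} (h : p ∈ affine j) :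
    point j (affineCoord j (veronese p)) = p := by
  obtain ⟨w, rfl⟩ := h
  rw [affineCoord_veronese_point]

theorem veronese_injective : Function.Injective veronese := fun p q h => by
  obtain ⟨j, hj⟩ := exists_mem_affine p
  have hq : q ∈ affine j := by rwa [← veronese_diag_ne_zero_iff, ← h, veronese_diag_ne_zero_iff]
  rw [← affineCoord_veronese hj, h, affineCoord_veronese hq]

/-! ### The reflection as a linear isometry of Hermitian matrices. -/

/-- The action of the reflection with parameters `r, l` on Hermitian matrices. -/
def hermReflection (r : ℝ) (l : Octonion) : Herm →ₗ[ℝ] Herm where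
  -- For `x = (1, u, v)` the off-diagonal entries of `x x*` are `ū`, `u v̄`, `v`. The formulas are
  -- the entries belonging to `(1, ru + λv, λ̄u - rv)`, rewritten linearly in those of `x x*`.
  toFun X :=
    (![X.1 0, r ^ 2 * X.1 1 + ‖l‖ ^ 2 * X.1 2 + 2 * r * inner ℝ l (X.2 1),
      ‖l‖ ^ 2 * X.1 1 + r ^ 2 * X.1 2 - 2 * r * inner ℝ l (X.2 1)],
    ![star (r • star (X.2 0) + l * X.2 2),
      (r * (X.1 1 - X.1 2) + 2 * inner ℝ l (X.2 1)) • l - X.2 1,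
      star l * star (X.2 0) - r • X.2 2])
  map_add' X Y := by
    refine Prod.ext (funext fun k => ?_) (funext fun k => ?_)
    · fin_cases k <;> simp [inner_add_right] <;> ring
    · fin_cases k
      · simp [star_add', mul_add]; abel
      · simp [inner_add_right]; module
      · simp [star_add', mul_add]; abel
  map_smul' c X := by
    refine Prod.ext (funext fun k => ?_) (funext fun k => ?_)
    · fin_cases k <;> simp [inner_smul_right] <;> ring
    · fin_cases k
      · simp [star_smul', Octonion.mul_smul, star_add', smul_smul, mul_comm]
      · simp [inner_smul_right]; module
      · simp [star_smul', Octonion.mul_smul, smul_sub, smul_smul, mul_comm]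

section Reflection

variable {r : ℝ} {l : Octonion}

theorem norm_reflection_fst (r : ℝ) (l u v : Octonion) : ‖r • u + l * v‖ ^ 2 =
    r ^ 2 * ‖u‖ ^ 2 + ‖l‖ ^ 2 * ‖v‖ ^ 2 + 2 * r * inner ℝ l (u * star v) := by
  rw [norm_add_sq_real, norm_smul, mul_pow, norm_mul_sq, inner_smul_left, ← inner_mul_right,
    real_inner_comm u, Real.norm_eq_abs, sq_abs]
  simp
  ring

theorem norm_reflection_snd (r : ℝ) (l u v : Octonion) : ‖star l * u - r • v‖ ^ 2 =
    ‖l‖ ^ 2 * ‖u‖ ^ 2 + r ^ 2 * ‖v‖ ^ 2 - 2 * r * inner ℝ l (u * star v) := by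
  rw [norm_sub_sq_real, norm_smul, mul_pow, norm_mul_sq, norm_star', inner_smul_right,
    ← inner_mul_right, inner_mul_left l v u, real_inner_comm v, Real.norm_eq_abs, sq_abs]
  ring

theorem norm_reflection (h : r ^ 2 + ‖l‖ ^ 2 = 1) (u v : Octonion) :
    ‖r • u + l * v‖ ^ 2 + ‖star l * u - r • v‖ ^ 2 = ‖u‖ ^ 2 + ‖v‖ ^ 2 := by
  rw [norm_reflection_fst, norm_reflection_snd]
  linear_combination (‖u‖ ^ 2 + ‖v‖ ^ 2) * h

/-- The entries `X.2 0` and `X.2 2` undergo the octonionic reflection, an isometry by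
`norm_reflection`; on the remaining block the claim is a polynomial identity once `|l|² = 1 - r²`.
It is needed for all `X`, not only projections, since it is applied to tangent vectors. -/
theorem hsNormSq_hermReflection (h : r ^ 2 + ‖l‖ ^ 2 = 1) (X : Herm) :
    hsNormSq (hermReflection r l X) = hsNormSq X := by
  have h1 := norm_reflection h (star (X.2 0)) (X.2 2)
  rw [norm_star'] at h1
  simp only [hsNormSq, Fin.sum_univ_three, hermReflection, LinearMap.coe_mk, AddHom.coe_mk,
    Matrix.cons_val, norm_star']
  have h2 : ∀ c : ℝ, ‖c • l - X.2 1‖ ^ 2 =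
      c ^ 2 * ‖l‖ ^ 2 - 2 * c * inner ℝ l (X.2 1) + ‖X.2 1‖ ^ 2 := fun c => by
    rw [norm_sub_sq_real, norm_smul, mul_pow, inner_smul_left, Real.norm_eq_abs, sq_abs]
    simp
    ring
  rw [h2]
  have h3 : ‖l‖ ^ 2 = 1 - r ^ 2 := by linear_combination h
  rw [h3]
  linear_combination 2 * h1

/-- Of the four products only `(l v)(ū l)` is beyond alternativity, and `mul_mul_star_mul_self`
handles it. The terms `-r² u v̄` and `-|l|² u v̄` then merge by `h`. -/
theorem reflection_mul_star (h : r ^ 2 + ‖l‖ ^ 2 = 1) (u v : Octonion) :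
    (r • u + l * v) * star (star l * u - r • v) =
      (r * (‖u‖ ^ 2 - ‖v‖ ^ 2) + 2 * inner ℝ l (u * star v)) • l - u * star v := by
  have h1 := mul_mul_star_mul_self l v u
  have h2 : star (star l * u - r • v) = star u * l - r • star v := by
    rw [sub_eq_add_neg, star_add', star_mul', star_star', ← neg_smul, star_smul', neg_smul,
      ← sub_eq_add_neg]
  have h3 : u * (star u * l) = (‖u‖ ^ 2) • l := mul_star_mul u l
  have h4 : (l * v) * star v = (‖v‖ ^ 2) • l := mul_mul_star l v
  have h5 : u * star v = (r ^ 2 + ‖l‖ ^ 2) • (u * star v) := by rw [h, one_smul]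
  rw [h2, mul_sub, add_mul, add_mul, Octonion.smul_mul, Octonion.smul_mul, Octonion.mul_smul,
    Octonion.mul_smul, h1, h3, h4]
  linear_combination (norm := module) h5

theorem veronese_reflection_point (h : r ^ 2 + ‖l‖ ^ 2 = 1) (w : Model) :
    veronese (reflection r l (point 0 w)) = hermReflection r l (veronese (point 0 w)) := by
  obtain ⟨u, v⟩ := w
  rw [reflection_point, veronese_point, veronese_point, projMatrix, projMatrix, map_smul]
  have hN : normSq (triple 0 (r • u + l * v, star l * u - r • v)) = normSq (triple 0 (u, v)) := by
    simp only [normSq, Fin.sum_univ_three, triple, Matrix.cons_val]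
    linear_combination norm_reflection h u v
  rw [hN]
  congr 1
  refine Prod.ext (funext fun k => ?_) (funext fun k => ?_)
  · fin_cases k
    · rfl
    · simpa [outer, triple, hermReflection] using norm_reflection_fst r l u v
    · simpa [outer, triple, hermReflection] using norm_reflection_snd r l u v
  · fin_cases k
    · simp [outer, triple, hermReflection, star_star', star_one']
    · simpa [outer, triple, hermReflection] using reflection_mul_star h u v
    · simp [outer, triple, hermReflection, star_star', star_one']

end Reflection

/-! ### The line at infinity is preserved. -/

/-- The projection matrices of the points of the line `[0, *, *]`. -/
theorem exists_veronese_eq {X : Herm} (hd : X.1 0 = 0) (h0 : X.2 0 = 0) (h2 : X.2 2 = 0)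
    (ht : X.1 1 + X.1 2 = 1) (hb : ‖X.2 1‖ ^ 2 = X.1 1 * X.1 2) : ∃ p, veronese p = X := by
  by_cases h1 : X.1 1 = 0
  · have hb' : X.2 1 = 0 := by simpa [h1] using hb
    have h2' : X.1 2 = 1 := by simpa [h1] using ht
    refine ⟨point 2 (0, 0), ?_⟩
    refine Prod.ext (funext fun k => ?_) (funext fun k => ?_)
    · fin_cases k <;> simp [veronese_point, projMatrix, outer, normSq, Fin.sum_univ_three, triple,
        hd, h1, h2', norm_one_sq]
    · fin_cases k <;> simp [veronese_point, projMatrix, outer, normSq, Fin.sum_univ_three, triple,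
        h0, hb', h2, star_zero']
  -- For `[0, 1, z]` the matrix has `X.1 1 = 1/N` and `X.2 1 = z̄/N` with `N = 1 + |z|²`, which
  -- forces this `z`.
  · refine ⟨point 1 (0, (X.1 1)⁻¹ • star (X.2 1)), ?_⟩
    have hv : ‖(X.1 1)⁻¹ • star (X.2 1)‖ ^ 2 = (X.1 1)⁻¹ * X.1 2 := by
      rw [norm_smul, mul_pow, norm_star', hb, Real.norm_eq_abs, sq_abs]
      field_simp
    have hN : normSq (triple 1 (0, (X.1 1)⁻¹ • star (X.2 1))) = (X.1 1)⁻¹ := by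
      simp only [normSq, Fin.sum_univ_three, triple, Matrix.cons_val, hv, norm_one_sq, norm_zero]
      field_simp
      linear_combination ht
    rw [veronese_point, projMatrix, hN, inv_inv]
    refine Prod.ext (funext fun k => ?_) (funext fun k => ?_)
    · fin_cases k
      · simp [outer, triple, hd]
      · simp [outer, triple, norm_one_sq]
      · simp only [outer, Prod.smul_fst, Pi.smul_apply, triple, Fin.reduceFinMk, Matrix.cons_val,
          hv, smul_eq_mul]
        field_simp
    · fin_cases k
      · simp [outer, triple, h0]
      · simp [outer, triple, star_smul', star_star', smul_smul, h1]
      · simp [outer, triple, h2, star_zero']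

/-- Off `affine 0` the matrix lives in the lower `2 × 2` block, where trace `1` and determinant `0`
characterize the image of `veronese`. -/
theorem exists_veronese_eq_hermReflection {r : ℝ} {l : Octonion} (h : r ^ 2 + ‖l‖ ^ 2 = 1)
    (p : OP2) : ∃ q, veronese q = hermReflection r l (veronese p) := by
  by_cases hp : p ∈ affine 0
  · obtain ⟨w, rfl⟩ := hp
    exact ⟨_, veronese_reflection_point h w⟩
  · obtain ⟨i, w, rfl⟩ := exists_point p
    have hw : triple i w 0 = 0 := by
      by_contra hne
      exact hp ((point_mem_affine_iff i 0 w).2 hne)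
    have hN := (normSq_pos (triple_self i w)).ne'
    set x := triple i w with hx
    have hs : normSq x = ‖x 1‖ ^ 2 + ‖x 2‖ ^ 2 := by
      simp [normSq, Fin.sum_univ_three, hw]
    rw [veronese_point, ← hx]
    have hX0 : (projMatrix x).1 0 = 0 := by simp [projMatrix, outer, hw]
    have hX1 : (projMatrix x).2 0 = 0 := by simp [projMatrix, outer, hw]
    have hX2 : (projMatrix x).2 2 = 0 := by simp [projMatrix, outer, hw, star_zero']
    have ht : (projMatrix x).1 1 + (projMatrix x).1 2 = 1 := by
      simp only [projMatrix, outer, Prod.smul_fst, Pi.smul_apply, smul_eq_mul]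
      rw [← mul_add, ← hs, inv_mul_cancel₀ hN]
    have hb : ‖(projMatrix x).2 1‖ ^ 2 = (projMatrix x).1 1 * (projMatrix x).1 2 := by
      simp only [projMatrix, outer, Prod.smul_fst, Prod.smul_snd, Pi.smul_apply, smul_eq_mul]
      rw [norm_smul, mul_pow, norm_mul_sq, norm_star', Real.norm_eq_abs, sq_abs]
      rw [show (1 + 1 : Fin 3) = 2 from rfl]
      ring
    generalize projMatrix x = X at *
    -- On the block, squared norm = trace² - 2 det. Trace and norm are preserved, hence so is the
    -- vanishing determinant.
    have hQ := hsNormSq_hermReflection h X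
    have k0 : (hermReflection r l X).1 0 = 0 := hX0
    have k1 : (hermReflection r l X).2 0 = 0 := by
      simp [hermReflection, hX1, hX2, star_zero']
    have k2 : (hermReflection r l X).2 2 = 0 := by
      simp [hermReflection, hX1, hX2, star_zero']
    have k3 : (hermReflection r l X).1 1 + (hermReflection r l X).1 2 = 1 := by
      simp only [hermReflection, LinearMap.coe_mk, AddHom.coe_mk, Matrix.cons_val]
      linear_combination ht + (X.1 1 + X.1 2) * h
    refine exists_veronese_eq k0 k1 k2 k3 ?_
    simp only [hsNormSq, Fin.sum_univ_three, k0, k1, k2, hX0, hX1, hX2, norm_zero] at hQ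
    generalize hermReflection r l X = Y at *
    linear_combination (hQ + (X.1 1 + X.1 2 + 1) * ht - (Y.1 1 + Y.1 2 + 1) * k3) / 2 + hb

/-! ### The line element as a pulled-back Hilbert-Schmidt metric. -/

/-- The derivative of `triple i`: the vector `(0, a, b)`, `(a, 0, b)` or `(a, b, 0)`. -/
def tangentTriple (i : Fin 3) (d : Model) : Fin 3 → Octonion :=
  match i with
  | 0 => ![0, d.1, d.2]
  | 1 => ![d.1, 0, d.2]
  | 2 => ![d.1, d.2, 0]

theorem triple_add_smul (i : Fin 3) (w d : Model) (t : ℝ) :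
    triple i (w + t • d) = triple i w + t • tangentTriple i d := by
  funext k
  fin_cases i <;> fin_cases k <;> simp [triple, tangentTriple]

/-- The derivative of `outer` at `y` in the direction `η`. -/
def outerDeriv (y η : Fin 3 → Octonion) : Herm :=
  (fun k => 2 * inner ℝ (y k) (η k), fun k => y k * star (η (k + 1)) + η k * star (y (k + 1)))

theorem outer_add_smul (y η : Fin 3 → Octonion) (t : ℝ) :
    outer (y + t • η) = outer y + t • outerDeriv y η + t ^ 2 • outer η := by
  refine Prod.ext (funext fun k => ?_) (funext fun k => ?_)
  · simp only [outer, outerDeriv, Prod.fst_add, Prod.smul_fst, Pi.add_apply, Pi.smul_apply,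
      smul_eq_mul]
    rw [norm_add_sq_real, norm_smul, mul_pow, inner_smul_right, Real.norm_eq_abs, sq_abs]
    ring
  · simp only [outer, outerDeriv, Prod.snd_add, Prod.smul_snd, Pi.add_apply, Pi.smul_apply,
      star_add', star_smul', mul_add, add_mul, Octonion.smul_mul, Octonion.mul_smul]
    module

theorem hasDerivAt_outer (y η : Fin 3 → Octonion) :
    HasDerivAt (fun t : ℝ => outer (y + t • η)) (outerDeriv y η) 0 := by
  simp only [outer_add_smul]
  have h := ((hasDerivAt_const (0 : ℝ) (outer y)).add
    ((hasDerivAt_id (0 : ℝ)).smul_const (outerDeriv y η))).add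
      (((hasDerivAt_id (0 : ℝ)).pow 2).smul_const (outer η))
  simpa using! h

theorem hasDerivAt_normSq (y η : Fin 3 → Octonion) :
    HasDerivAt (fun t : ℝ => normSq (y + t • η)) (2 * ∑ k, inner ℝ (y k) (η k)) 0 := by
  have h := (hasDerivAt_pi.1 (hasDerivAt_outer y η).fst)
  have h2 := HasDerivAt.fun_sum (u := Finset.univ) fun k _ => h k
  rw [Finset.mul_sum]
  exact h2

theorem hasDerivAt_projMatrix {y : Fin 3 → Octonion} (η : Fin 3 → Octonion)
    (hy : normSq y ≠ 0) :
    HasDerivAt (fun t : ℝ => projMatrix (y + t • η))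
      ((normSq y)⁻¹ • outerDeriv y η -
        ((normSq y)⁻¹ ^ 2 * (2 * ∑ k, inner ℝ (y k) (η k))) • outer y) 0 := by
  have h0 : y + (0 : ℝ) • η = y := by simp
  have h := ((hasDerivAt_normSq y η).fun_inv (by rwa [h0])).fun_smul (hasDerivAt_outer y η)
  rw [h0] at h
  refine h.congr_deriv ?_
  rw [sub_eq_add_neg, ← neg_smul]
  congr 2
  rw [div_eq_mul_inv, inv_pow]
  ring

/-- This is the off-diagonal contribution to the squared norm of the derivative of `projMatrix`; `a`
and `b` are the coefficients coming from the quotient rule. -/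
theorem norm_outerDeriv_sub (a b : ℝ) (y η y' η' : Octonion) :
    ‖a • (y * star η' + η * star y') - b • (y * star y')‖ ^ 2 =
      a ^ 2 * (‖y‖ ^ 2 * ‖η'‖ ^ 2 + ‖η‖ ^ 2 * ‖y'‖ ^ 2 +
        2 * inner ℝ (y * star η') (η * star y')) -
      2 * a * b * (‖y‖ ^ 2 * inner ℝ y' η' + ‖y'‖ ^ 2 * inner ℝ y η) +
      b ^ 2 * (‖y‖ ^ 2 * ‖y'‖ ^ 2) := by
  rw [norm_sub_sq_real, norm_smul, norm_smul, mul_pow, mul_pow, norm_add_sq_real, norm_mul_sq,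
    norm_mul_sq, norm_mul_sq, inner_smul_left, inner_smul_right, inner_add_left,
    inner_mul_mul_left, inner_mul_mul_right, inner_star, Real.norm_eq_abs, Real.norm_eq_abs,
    sq_abs, sq_abs, norm_star', norm_star', real_inner_comm y', real_inner_comm y]
  simp only [conj_trivial]
  ring

/-- In the chart `(u, 1, v)` the product of the two coordinates sits at position `(2, 0)`, so `u`
and `v` appear in reversed order; this restores the common form. -/
theorem inner_mul_star_swap (u v a b : Octonion) :
    inner ℝ (v * star a) (b * star u) = inner ℝ (u * star b) (a * star v) := by
  rw [← inner_star, star_mul', star_mul', star_star', star_star', real_inner_comm]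

/-- The line element is half the Hilbert-Schmidt metric pulled back by the Veronese embedding. -/
theorem hsNormSq_projMatrix_deriv (i : Fin 3) (w d : Model) :
    hsNormSq ((normSq (triple i w))⁻¹ • outerDeriv (triple i w) (tangentTriple i d) -
        ((normSq (triple i w))⁻¹ ^ 2 *
          (2 * ∑ k, inner ℝ (triple i w k) (tangentTriple i d k))) • outer (triple i w)) =
      2 * lineElement w d := by
  obtain ⟨u, v⟩ := w
  obtain ⟨a, b⟩ := d
  have hN : 1 + ‖u‖ ^ 2 + ‖v‖ ^ 2 ≠ 0 := by positivity
  rw [lineElement]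
  simp only [re_mul_mul_star]
  fin_cases i
  all_goals
    simp only [hsNormSq, normSq, outer, outerDeriv, Fin.sum_univ_three, Prod.fst_sub, Prod.snd_sub,
      Prod.smul_fst, Prod.smul_snd, Pi.sub_apply, Pi.smul_apply, smul_eq_mul, norm_outerDeriv_sub]
    simp only [triple, tangentTriple, Fin.reduceAdd, Matrix.cons_val, norm_one_sq,
      inner_zero_right, inner_zero_left, norm_zero, star_zero', mul_zero, zero_mul,
      inner_mul_star_swap u v a b]
  · field_simp
    ring
  · rw [show ‖u‖ ^ 2 + 1 + ‖v‖ ^ 2 = 1 + ‖u‖ ^ 2 + ‖v‖ ^ 2 by ring]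
    field_simp
    ring
  · rw [show ‖u‖ ^ 2 + ‖v‖ ^ 2 + 1 = 1 + ‖u‖ ^ 2 + ‖v‖ ^ 2 by ring]
    field_simp
    ring

theorem contDiff_projMatrix_triple (i : Fin 3) :
    ContDiff ℝ ω (fun w : Model => projMatrix (triple i w)) := by
  have hd : ∀ k, ContDiff ℝ ω (fun w : Model => ‖triple i w k‖ ^ 2) := fun k =>
    (contDiff_triple i k).norm_sq ℝ
  have hN : ContDiff ℝ ω (fun w : Model => normSq (triple i w)) :=
    ContDiff.sum fun k _ => hd k
  have hO : ContDiff ℝ ω (fun w : Model => outer (triple i w)) := by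
    refine (contDiff_pi.2 hd).prodMk (contDiff_pi.2 fun k => ?_)
    have hs : ContDiff ℝ ω (fun w : Model => star (triple i w (k + 1))) :=
      ContDiff.comp (g := fun a : Octonion => star a) contDiff_star (contDiff_triple i (k + 1))
    have hp := (contDiff_triple i k).prodMk hs
    have := ContDiff.comp (g := fun p : Octonion × Octonion => p.1 * p.2) contDiff_mul hp
    exact this
  exact (hN.inv fun w => (normSq_pos (triple_self i w)).ne').smul hO

theorem hsNormSq_fderiv (i : Fin 3) (w d : Model) :
    hsNormSq (fderiv ℝ (fun w : Model => projMatrix (triple i w)) w d) = 2 * lineElement w d := by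
  have hdiff := (contDiff_projMatrix_triple i).differentiable (by simp) w
  have h := hasDerivAt_projMatrix (tangentTriple i d) (normSq_pos (triple_self i w)).ne'
  simp only [← triple_add_smul] at h
  have hline : HasLineDerivAt ℝ (fun w : Model => projMatrix (triple i w)) _ w d := h
  rw [← hdiff.lineDeriv_eq_fderiv, hline.lineDeriv, hsNormSq_projMatrix_deriv]

/-! ### Analyticity, the Hausdorff property, and density of the first chart. -/

theorem contDiffAt_affineCoord {j : Fin 3} {X : Herm} (h : X.1 j ≠ 0) :
    ContDiffAt ℝ ω (affineCoord j) X := by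
  have hd : ContDiffAt ℝ ω (fun X : Herm => (X.1 j)⁻¹) X :=
    ContDiffAt.inv ((contDiff_apply ℝ ℝ j).comp contDiff_fst).contDiffAt h
  have ho : ∀ k, ContDiff ℝ ω (fun X : Herm => X.2 k) := fun k =>
    (contDiff_apply ℝ Octonion k).comp contDiff_snd
  have hc : ∀ k, ContDiffAt ℝ ω
      (fun X : Herm => (X.1 j)⁻¹ • if k = j + 1 then star (X.2 j) else X.2 (j + 2)) X := by
    intro k
    refine hd.smul ?_
    split_ifs
    · exact (contDiff_star.comp (ho j)).contDiffAt
    · exact (ho _).contDiffAt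
  unfold affineCoord entries
  fin_cases j
  · exact (hc 1).prodMk (hc 2)
  · exact (hc 0).prodMk (hc 2)
  · exact (hc 0).prodMk (hc 1)

/-- The `i`-th affine chart as an open partial homeomorphism. -/
def affineChart (i : Fin 3) : OpenPartialHomeomorph OP2 Model :=
  atlasCore.openPartialHomeomorph (affineEquiv i) (Set.mem_range_self i)

theorem affineChart_mem_maximalAtlas (i : Fin 3) :
    affineChart i ∈ IsManifold.maximalAtlas 𝓘(ℝ, Model) ω OP2 :=
  IsManifold.subset_maximalAtlas (mem_atlas_iff.2 ⟨_, Set.mem_range_self i, rfl⟩)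

theorem isOpen_affine (i : Fin 3) : IsOpen (affine i) := (affineChart i).open_source

theorem contMDiffAt_affineEquiv {i : Fin 3} {p : OP2} (h : p ∈ affine i) :
    ContMDiffAt 𝓘(ℝ, Model) 𝓘(ℝ, Model) ω (affineEquiv i) p :=
  contMDiffAt_of_mem_maximalAtlas (affineChart_mem_maximalAtlas i) h

theorem contMDiff_point (i : Fin 3) : ContMDiff 𝓘(ℝ, Model) 𝓘(ℝ, Model) ω (point i) := fun w =>
  contMDiffAt_symm_of_mem_maximalAtlas (affineChart_mem_maximalAtlas i) (Set.mem_univ w)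

theorem veronese_eventuallyEq {i : Fin 3} {p : OP2} (h : p ∈ affine i) :
    veronese =ᶠ[nhds p] (fun w : Model => projMatrix (triple i w)) ∘ affineEquiv i := by
  filter_upwards [(isOpen_affine i).mem_nhds h] with q hq
  obtain ⟨w, rfl⟩ := hq
  rw [Function.comp_apply, affineEquiv_point, veronese_point]

theorem contMDiff_veronese : ContMDiff 𝓘(ℝ, Model) 𝓘(ℝ, Herm) ω veronese := fun p => by
  obtain ⟨i, hi⟩ := exists_mem_affine p
  refine ContMDiffAt.congr_of_eventuallyEq ?_ (veronese_eventuallyEq hi)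
  exact (contDiff_projMatrix_triple i).contMDiff.contMDiffAt.comp p (contMDiffAt_affineEquiv hi)

/-- Continuous maps into the plane that agree on a dense set must coincide; this separation is what
the uniqueness and involution arguments use. -/
instance : T2Space OP2 := T2Space.of_injective_continuous veronese_injective
  contMDiff_veronese.continuous

/-- The right side does not mention `i`, so charts disappear from every later metric computation. -/
theorem dsSq_eq_hsNormSq {i : Fin 3} {p : OP2} (h : p ∈ affine i)
    (ξ : TangentSpace 𝓘(ℝ, Model) p) :
    dsSq i p ξ = hsNormSq (mfderiv 𝓘(ℝ, Model) 𝓘(ℝ, Herm) veronese p ξ) / 2 := by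
  have h1 := ((contDiff_projMatrix_triple i).differentiable (by simp)
    (affineEquiv i p)).hasFDerivAt.hasMFDerivAt
  have h2 := ((contMDiffAt_affineEquiv h).mdifferentiableAt (by simp)).hasMFDerivAt
  have h3 := ((h1.comp p h2).congr_of_eventuallyEq (veronese_eventuallyEq h)).mfderiv
  rw [h3, eq_div_iff two_ne_zero, mul_comm]
  exact (hsNormSq_fderiv i _ _).symm

theorem dense_affine_zero : Dense (affine 0) := fun p => by
  obtain ⟨i, w, rfl⟩ := exists_point p
  have : Nontrivial Octonion := ⟨1, 0, one_ne_zero'⟩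
  have := Module.punctured_nhds_neBot ℝ Octonion 0
  -- In the charts `1` and `2` the homogeneous coordinate `x 0` is `z.1`, so this set lands in
  -- `affine 0`; in chart `0` every point does.
  have hd : Dense {z : Model | z.1 ≠ 0} :=
    (dense_compl_singleton (0 : Octonion)).preimage isOpenMap_fst
  refine map_mem_closure (contMDiff_point i).continuous (hd w) fun z hz => ?_
  rw [point_mem_affine_iff]
  fin_cases i
  · exact one_ne_zero'
  · exact hz
  · exact hz

theorem reflection_reflection {r : ℝ} {l : Octonion} (h : r ^ 2 + ‖l‖ ^ 2 = 1) {p : OP2}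
    (hp : p ∈ affine 0) : reflection r l (reflection r l p) = p := by
  obtain ⟨⟨u, v⟩, rfl⟩ := hp
  rw [reflection_point, reflection_point]
  congr 2
  · rw [mul_sub, mul_star_mul, Octonion.mul_smul]
    linear_combination (norm := module) h • u
  · rw [mul_add, star_mul_mul, Octonion.mul_smul]
    linear_combination (norm := module) h • v

/-! ### The extended reflection and its properties. -/

/-- The extension of `reflection r l` to `𝕆P²`. -/
def projReflection {r : ℝ} {l : Octonion} (h : r ^ 2 + ‖l‖ ^ 2 = 1) (p : OP2) : OP2 :=
  (exists_veronese_eq_hermReflection h p).choose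

section ProjReflection

variable {r : ℝ} {l : Octonion} (h : r ^ 2 + ‖l‖ ^ 2 = 1)

theorem veronese_projReflection (p : OP2) :
    veronese (projReflection h p) = hermReflection r l (veronese p) :=
  (exists_veronese_eq_hermReflection h p).choose_spec

theorem eqOn_projReflection : Set.EqOn (projReflection h) (reflection r l) (affine 0) := by
  rintro _ ⟨w, rfl⟩
  apply veronese_injective
  rw [veronese_projReflection, veronese_reflection_point h]

/-- Near `p` the map factors as `point j ∘ affineCoord j ∘ hermReflection r l ∘ veronese`, with `j`
a chart around the image of `p`; every factor is analytic there. -/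
theorem contMDiff_projReflection :
    ContMDiff 𝓘(ℝ, Model) 𝓘(ℝ, Model) ω (projReflection h) := fun p => by
  obtain ⟨j, hj⟩ := exists_mem_affine (projReflection h p)
  have hc : ContMDiff 𝓘(ℝ, Model) 𝓘(ℝ, Herm) ω (fun q => veronese (projReflection h q)) := by
    simp only [veronese_projReflection]
    exact (LinearMap.toContinuousLinearMap (hermReflection r l)).contDiff.contMDiff.comp
      contMDiff_veronese
  have hj' := (veronese_diag_ne_zero_iff _ j).2 hj
  have heq : projReflection h =ᶠ[nhds p]
      fun q => point j (affineCoord j (veronese (projReflection h q))) := by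
    have hcont : Continuous fun q => (veronese (projReflection h q)).1 j :=
      (continuous_apply j).comp (continuous_fst.comp hc.continuous)
    filter_upwards [hcont.continuousAt.eventually_ne hj'] with q hq
    exact (affineCoord_veronese ((veronese_diag_ne_zero_iff _ j).1 hq)).symm
  refine ContMDiffAt.congr_of_eventuallyEq ?_ heq
  exact (contMDiff_point j).contMDiffAt.comp p
    (ContMDiffAt.comp (g := affineCoord j) p (contDiffAt_affineCoord hj').contMDiffAt
      hc.contMDiffAt)

theorem projReflection_mem_affine_zero_iff (p : OP2) :
    projReflection h p ∈ affine 0 ↔ p ∈ affine 0 := by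
  rw [← veronese_diag_ne_zero_iff, ← veronese_diag_ne_zero_iff, veronese_projReflection]
  rfl

theorem involutive_projReflection : Function.Involutive (projReflection h) := by
  have hF := (contMDiff_projReflection h).continuous
  refine congrFun (Continuous.ext_on dense_affine_zero (hF.comp hF) continuous_id fun p hp => ?_)
  have hp' := (projReflection_mem_affine_zero_iff h p).2 hp
  change projReflection h (projReflection h p) = p
  rw [eqOn_projReflection h hp', eqOn_projReflection h hp,
    reflection_reflection h hp]

/-- Differentiating `veronese ∘ projReflection h = T ∘ veronese` with `T` linear turns the claim
into norm preservation by `T`. -/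
theorem dsSq_projReflection {p : OP2} {i j : Fin 3} (hi : p ∈ affine i)
    (hj : projReflection h p ∈ affine j) (ξ : TangentSpace 𝓘(ℝ, Model) p) :
    dsSq j (projReflection h p)
      (mfderiv 𝓘(ℝ, Model) 𝓘(ℝ, Model) (projReflection h) p ξ) = dsSq i p ξ := by
  let T := LinearMap.toContinuousLinearMap (hermReflection r l)
  have hcomm : veronese ∘ projReflection h = T ∘ veronese :=
    funext (veronese_projReflection h)
  have h1 := mfderiv_comp_apply p (contMDiff_veronese.mdifferentiableAt (by simp))
    ((contMDiff_projReflection h).mdifferentiableAt (x := p) (by simp)) ξ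
  have h2 := mfderiv_comp_apply p (T.contDiff (n := ω).contMDiff.mdifferentiableAt (by simp))
    (contMDiff_veronese.mdifferentiableAt (x := p) (by simp)) ξ
  rw [mfderiv_eq_fderiv, T.fderiv] at h2
  rw [dsSq_eq_hsNormSq hi, dsSq_eq_hsNormSq hj, ← h1, hcomm, h2]
  exact congrArg (· / 2) (hsNormSq_hermReflection h _)

theorem isIsometryOn_projReflection : IsIsometryOn (projReflection h) Set.univ Set.univ where
  isOpen_source := isOpen_univ
  isOpen_target := isOpen_univ
  bijOn := Set.bijOn_univ.2 (involutive_projReflection h).bijective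
  contMDiffOn := (contMDiff_projReflection h).contMDiffOn
  contMDiffOn_inverse := ⟨projReflection h,
    ⟨fun p _ => involutive_projReflection h p, fun p _ => involutive_projReflection h p⟩,
    (contMDiff_projReflection h).contMDiffOn⟩
  dsSq_map _ _ _ _ hi hj ξ := dsSq_projReflection h hi hj ξ

end ProjReflection

theorem isIsometryOn_reflection {r : ℝ} {l : Octonion} (h : r ^ 2 + ‖l‖ ^ 2 = 1) :
    IsIsometryOn (reflection r l) (affine 0) (affine 0) where
  isOpen_source := isOpen_affine 0
  isOpen_target := isOpen_affine 0
  bijOn := by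
    refine Set.BijOn.congr ?_ (eqOn_projReflection h)
    refine Set.InvOn.bijOn (f' := projReflection h)
      ⟨fun p _ => involutive_projReflection h p, fun p _ => involutive_projReflection h p⟩ ?_ ?_ <;>
    exact fun p hp => (projReflection_mem_affine_zero_iff h p).2 hp
  contMDiffOn := (contMDiff_projReflection h).contMDiffOn.congr
    fun p hp => (eqOn_projReflection h hp).symm
  contMDiffOn_inverse := ⟨reflection r l,
    ⟨fun _ hp => reflection_reflection h hp, fun _ hp => reflection_reflection h hp⟩,
    (contMDiff_projReflection h).contMDiffOn.congr fun p hp => (eqOn_projReflection h hp).symm⟩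
  dsSq_map p hp i j hi hj ξ := by
    -- The derivative depends only on the germ at `p`, and `affine 0` is open; outside it
    -- `reflection` takes meaningless values.
    have heq : reflection r l =ᶠ[nhds p] projReflection h := by
      filter_upwards [(isOpen_affine 0).mem_nhds hp] with q hq
      exact (eqOn_projReflection h hq).symm
    have hfp := heq.eq_of_nhds
    have hj' : projReflection h p ∈ affine j := hfp ▸ hj
    rw [heq.mfderiv_eq, hfp]
    exact dsSq_projReflection h hi hj' ξ

end OP2

end

theorem mainTheorem8 (r : ℝ) (l : Octonion) (h : r ^ 2 + ‖l‖ ^ 2 = 1) :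
    OP2.IsIsometryOn (OP2.reflection r l) (OP2.affine 0) (OP2.affine 0) ∧
      ∃ F : OP2 → OP2,
        ContMDiff 𝓘(ℝ, OP2.Model) 𝓘(ℝ, OP2.Model) ω F ∧
        Set.EqOn F (OP2.reflection r l) (OP2.affine 0) ∧
        (∀ G : OP2 → OP2, ContMDiff 𝓘(ℝ, OP2.Model) 𝓘(ℝ, OP2.Model) ω G →
          Set.EqOn G (OP2.reflection r l) (OP2.affine 0) → G = F) ∧
        Function.Involutive F ∧
        OP2.IsIsometryOn F Set.univ Set.univ := by
  refine ⟨OP2.isIsometryOn_reflection h, OP2.projReflection h, OP2.contMDiff_projReflection h,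
    OP2.eqOn_projReflection h, fun G hG hGr => ?_, OP2.involutive_projReflection h,
    OP2.isIsometryOn_projReflection h⟩
  -- Only continuity of `G` is used: two continuous extensions from a dense set agree.
  exact Continuous.ext_on OP2.dense_affine_zero hG.continuous
    (OP2.contMDiff_projReflection h).continuous
    (hGr.trans (OP2.eqOn_projReflection h).symm)
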